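/- Throughout, Hilbert spaces are complex and separable, $[\mathcal H,\mathcal K]$ denotes the bounded linear operators from $\mathcal H$ to $\mathcal K$, $[\mathcal H]=[\mathcal H,\mathcal H]$, $\operatorname{Re}T=\frac12(T+T^*)$, $\operatorname{Im}T=\frac1{2i}(T-T^*)$, $m$ is Lebesgue measure on $\mathbb R$, and $\mathcal B_b(\mathbb R)$ is the ring of bounded Borel subsets of $\mathbb R$. An operator measure in $\mathcal H$ is a strongly countably additive map $\Sigma:\mathcal B_b(\mathbb R)\to[\mathcal H]$ with $\Sigma(\emptyset)=0$ and $\Sigma(\delta)=\Sigma(\delta)^*\ge 0$ for all $\delta$. Its Lebesgue decomposition is $\Sigma=\Sigma^{ac}+\Sigma^{s}$, where $\Sigma^{ac},\Sigma^{s}$ are operator measures, $\Sigma^{ac}(\delta)=0$ whenever $m(\delta)=0$, and there is a Borel set $\delta_0$ with $m(\delta_0)=0$ and $\Sigma^s(\delta)=\Sigma^s(\delta\cap\delta_0)$ for all $\delta\in\mathcal B_b(\mathbb R)$. **Lemma 3.1.** For $j\in\{1,2\}$ let $F_j:\mathbb C\setminus\mathbb R\to[\mathcal H_j]$ be an operator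 Nevanlinna function, i.e. $F_j$ is holomorphic, $\operatorname{Im}z\cdot\operatorname{Im}F_j(z)\ge 0$ and $F_j(z)^*=F_j(\overline z)$, with parameters $C_j,D_j$ and spectral measure $\Sigma_j$; that is, $$F_j(z)=C_j+D_jz+\int_{\mathbb R}\Bigl(\frac1{t-z}-\frac t{1+t^2}\Bigr)\,d\Sigma_j(t),\qquad z\in\mathbb C\setminus\mathbb R,$$ where $C_j=C_j^*\in[\mathcal H_j]$, $0\le D_j\in[\mathcal H_j]$, $\Sigma_j$ is an operator measure in $\mathcal H_j$ with $\int_{\mathbb R}\frac{d\Sigma_j(t)}{1+t^2}\in[\mathcal H_j]$, and the integrals are understood in the strong sense. Let $\mathcal H$ be a Hilbert space, and let $B_j\in[\mathcal H_j]$ and $K_j\in[\mathcal H,\mathcal H_j]$, where $K_1,K_2$ have bounded everywhere defined inverses. Suppose that the set $$\Omega_+=\{z\in\mathbb C:\ \operatorname{Im}z>0,\ B_1-F_1(z)\text{ and }B_2-F_2(z)\text{ have bounded everywhere defined inverses}\}$$ is not empty. Put $$\widetilde\Sigma_j(\delta)=K_j^{-1}\Sigma_j(\delta)(K_j^{-1})^*\quad(\delta\in\mathcal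 B_b(\mathbb R)),\qquad \widetilde T_j=K_j^{-1}T_j(K_j^{-1})^*\quad\text{for }T\in\{B,C,D\}.$$ If $$K_1^*(B_1-F_1(z))^{-1}K_1=K_2^*(B_2-F_2(z))^{-1}K_2\qquad\text{for all }z\in\Omega_+,$$ then the Lebesgue decompositions of $\widetilde\Sigma_1$ and $\widetilde\Sigma_2$ exist, and for all $\delta\in\mathcal B_b(\mathbb R)$ $$\widetilde\Sigma_1^{s}(\delta)=\widetilde\Sigma_2^{s}(\delta),\qquad \widetilde\Sigma_2^{ac}(\delta)-\widetilde\Sigma_1^{ac}(\delta)=\frac{m(\delta)}{\pi}\bigl(\operatorname{Im}\widetilde B_2-\operatorname{Im}\widetilde B_1\bigr);$$ moreover $$\widetilde C_1-\operatorname{Re}\widetilde B_1=\widetilde C_2-\operatorname{Re}\widetilde B_2,\qquad \widetilde D_1=\widetilde D_2.$$ -/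

import Mathlib

open MeasureTheory Filter Topology Set
open scoped ComplexStarModule

namespace NevanlinnaOp

section Measures

variable {H : Type*} [NormedAddCommGroup H] [InnerProductSpace ℂ H] [CompleteSpace H]

/-- The ring of bounded Borel subsets of the real line. -/
def BoundedBorel : Set (Set ℝ) :=
  {δ | MeasurableSet δ ∧ Bornology.IsBounded δ}

/-- `S` is an operator measure: a strongly countably additive function on the bounded Borel sets
whose values are nonnegative (in particular self-adjoint) bounded operators.
Values of `S` at other sets are irrelevant. -/
structure IsOperatorMeasure (S : Set ℝ → (H →L[ℂ] H)) : Prop where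
  empty : S ∅ = 0
  nonneg : ∀ δ ∈ BoundedBorel, (S δ).IsPositive
  hasSum : ∀ δ : ℕ → Set ℝ, (∀ n, δ n ∈ BoundedBorel) → Pairwise (Function.onFun Disjoint δ) →
    (⋃ n, δ n) ∈ BoundedBorel → ∀ h : H, HasSum (fun n => S (δ n) h) (S (⋃ n, δ n) h)

/-- Absolute continuity with respect to Lebesgue measure. -/
def IsAC (S : Set ℝ → (H →L[ℂ] H)) : Prop :=
  ∀ δ ∈ BoundedBorel, volume δ = 0 → S δ = 0

/-- Singularity with respect to Lebesgue measure. -/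
def IsSingular (S : Set ℝ → (H →L[ℂ] H)) : Prop :=
  ∃ δ₀ : Set ℝ, MeasurableSet δ₀ ∧ volume δ₀ = 0 ∧ ∀ δ ∈ BoundedBorel, S δ = S (δ ∩ δ₀)

/-- `Sac` and `Ss` are the absolutely continuous and the singular part of `S`. -/
structure IsLebesgueDecomposition (S Sac Ss : Set ℝ → (H →L[ℂ] H)) : Prop where
  measure_ac : IsOperatorMeasure Sac
  measure_s : IsOperatorMeasure Ss
  add : ∀ δ ∈ BoundedBorel, S δ = Sac δ + Ss δ
  ac : IsAC Sac
  singular : IsSingular Ss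

/-- The integral over `δ` of a simple function against `S`. -/
noncomputable def simpleIntegral (S : Set ℝ → (H →L[ℂ] H)) (φ : SimpleFunc ℝ ℂ) (δ : Set ℝ) :
    H →L[ℂ] H :=
  ∑ c ∈ φ.range, c • S (φ ⁻¹' {c} ∩ δ)

/-- `T` is the integral of `f` over the bounded Borel set `δ` against `S`: the strong limit of
the integrals of simple functions that approximate `f` uniformly on `δ`. -/
def HasIntegralOn (S : Set ℝ → (H →L[ℂ] H)) (f : ℝ → ℂ) (δ : Set ℝ) (T : H →L[ℂ] H) : Prop :=
  ∃ φ : ℕ → SimpleFunc ℝ ℂ, TendstoUniformlyOn (fun n t => φ n t) f atTop δ ∧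
    ∀ h : H, Tendsto (fun n => simpleIntegral S (φ n) δ h) atTop (𝓝 (T h))

/-- `T` is the integral of `f` over `ℝ` against `S` in the strong sense: the strong limit of the
integrals over `[a, b]` as `a → -∞` and `b → ∞`. -/
def HasStrongIntegral (S : Set ℝ → (H →L[ℂ] H)) (f : ℝ → ℂ) (T : H →L[ℂ] H) : Prop :=
  ∃ I : ℝ → ℝ → (H →L[ℂ] H), (∀ a b, HasIntegralOn S f (Icc a b) (I a b)) ∧
    ∀ h : H, Tendsto (fun p : ℝ × ℝ => I p.1 p.2 h) (atBot ×ˢ atTop) (𝓝 (T h))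

/-- `F` is an `R`-function (operator Nevanlinna function). Its values on the real line are
irrelevant. -/
structure IsRFunction (F : ℂ → (H →L[ℂ] H)) : Prop where
  holomorphic : DifferentiableOn ℂ F {z | z.im ≠ 0}
  im_nonneg : ∀ z : ℂ, z.im ≠ 0 → (z.im • (ℑ (F z) : H →L[ℂ] H)).IsPositive
  adjoint_eq : ∀ z : ℂ, z.im ≠ 0 →
    ContinuousLinearMap.adjoint (F z) = F ((starRingEnd ℂ) z)

/-- `C`, `D` are the parameters and `S` is the spectral measure of `F`, i.e.
`F z = C + D z + ∫ (1 / (t - z) - t / (1 + t ^ 2)) dS` for nonreal `z`, where `C = C*`, `D ≥ 0`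
and `S` is an operator measure for which `∫ dS / (1 + t ^ 2)` is a bounded operator. -/
structure HasIntegralRepresentation (F : ℂ → (H →L[ℂ] H)) (C D : H →L[ℂ] H)
    (S : Set ℝ → (H →L[ℂ] H)) : Prop where
  selfAdjoint_C : IsSelfAdjoint C
  nonneg_D : D.IsPositive
  measure : IsOperatorMeasure S
  integrable : ∃ T : H →L[ℂ] H, HasStrongIntegral S (fun t => 1 / (1 + (t : ℂ) ^ 2)) T
  representation : ∀ z : ℂ, z.im ≠ 0 → ∃ T : H →L[ℂ] H,
    HasStrongIntegral S (fun t => 1 / ((t : ℂ) - z) - (t : ℂ) / (1 + (t : ℂ) ^ 2)) T ∧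
      F z = C + z • D + T

end Measures

section Transform

variable {H H₁ H₂ : Type*}
  [NormedAddCommGroup H] [InnerProductSpace ℂ H] [CompleteSpace H]
  [NormedAddCommGroup H₁] [InnerProductSpace ℂ H₁] [CompleteSpace H₁]
  [NormedAddCommGroup H₂] [InnerProductSpace ℂ H₂] [CompleteSpace H₂]

/-- The transform `K⁻¹ T K⁻¹*` of an operator `T`, for a boundedly invertible `K`. -/
noncomputable def tilde (K : H →L[ℂ] H₁) (T : H₁ →L[ℂ] H₁) : H →L[ℂ] H :=
  K.inverse ∘L T ∘L ContinuousLinearMap.adjoint K.inverse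

/-- The transform `K* (B - F z)⁻¹ K`. -/
noncomputable def transform (K : H →L[ℂ] H₁) (B : H₁ →L[ℂ] H₁) (F : ℂ → (H₁ →L[ℂ] H₁)) (z : ℂ) :
    H →L[ℂ] H :=
  ContinuousLinearMap.adjoint K ∘L (B - F z).inverse ∘L K

/-- The set of all `z` in the open upper half-plane for which both `B₁ - F₁ z` and `B₂ - F₂ z`
have bounded inverses. -/
def OmegaPlus (B₁ : H₁ →L[ℂ] H₁) (F₁ : ℂ → (H₁ →L[ℂ] H₁))
    (B₂ : H₂ →L[ℂ] H₂) (F₂ : ℂ → (H₂ →L[ℂ] H₂)) : Set ℂ :=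
  {z | 0 < z.im ∧ (B₁ - F₁ z).IsInvertible ∧ (B₂ - F₂ z).IsInvertible}

end Transform

end NevanlinnaOp

/-! On `OmegaPlus`, inverting both sides of the hypothesis gives `tilde K₁ (B₁ - F₁ z) = tilde K₂
(B₂ - F₂ z)`: the transformed functions differ by the constant `G = tilde K₁ B₁ - tilde K₂ B₂`.
Since `OmegaPlus` is open and nonempty, the identity theorem extends this to the whole upper
half-plane (`tilde_sub_tilde_eq`).

The rest compares integral representations through quadratic forms (`tilde_params_eq`). For fixed
`h`, the imaginary part says that the Poisson integrals of two scalar measures differ by `d * y +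
J`, with `J` the imaginary part of the form of `G`. The constant `J` is the Poisson integral of `J /
π` times Lebesgue measure, and the linear term vanishes as `y → 0`, so Stieltjes inversion
identifies the measures up to that multiple; then `d = 0`, which gives the equality of the `D`
terms. The real part at `z = i` contains only `C`. Polarization returns to operators.

The measures thus differ by an operator multiple of Lebesgue measure, which affects only the
absolutely continuous parts. -/

namespace NevanlinnaOp

/-! ### Poisson integrals and Stieltjes inversion for scalar measures. -/

section Poisson

instance isLocallyFiniteMeasure_add {μ ν : Measure ℝ} [IsLocallyFiniteMeasure μ]
    [IsLocallyFiniteMeasure ν] : IsLocallyFiniteMeasure (μ + ν) := by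
  refine ⟨fun x => ?_⟩
  obtain ⟨s, hs, hμs⟩ := μ.finiteAt_nhds x
  obtain ⟨t, ht, hνt⟩ := ν.finiteAt_nhds x
  refine ⟨s ∩ t, inter_mem hs ht, ?_⟩
  rw [Measure.add_apply]
  exact ENNReal.add_lt_top.2 ⟨(measure_mono inter_subset_left).trans_lt hμs,
    (measure_mono inter_subset_right).trans_lt hνt⟩

theorem poissonKernel_le (t x : ℝ) {y : ℝ} (hy : 0 < y) :
    y / ((t - x) ^ 2 + y ^ 2) ≤ (2 * y + (1 + 2 * x ^ 2) / y) * (1 + t ^ 2)⁻¹ := by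
  have h1 : 0 < 1 + t ^ 2 := by positivity
  have h2 : 0 < (t - x) ^ 2 + y ^ 2 := by positivity
  rw [← div_eq_mul_inv, div_le_div_iff₀ h2 h1]
  -- The constant comes from `2 (t - x)² = t² + (t - 2x)² - 2x²`; the summand `(1 + 2x²) / y`,
  -- multiplied by `y²`, cancels `-2x²y` and supplies the missing `y`.
  have h3 : (2 * y + (1 + 2 * x ^ 2) / y) * ((t - x) ^ 2 + y ^ 2) =
      y * (1 + t ^ 2) + (y * (t - 2 * x) ^ 2 + 2 * y ^ 3 +
        (1 + 2 * x ^ 2) / y * (t - x) ^ 2) := by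
    field_simp
    ring
  rw [h3]
  have : 0 ≤ y * (t - 2 * x) ^ 2 + 2 * y ^ 3 + (1 + 2 * x ^ 2) / y * (t - x) ^ 2 := by
    positivity
  linarith

theorem poissonKernel_nonneg (t x : ℝ) {y : ℝ} (hy : 0 < y) :
    0 ≤ y / ((t - x) ^ 2 + y ^ 2) := by positivity

theorem integrable_poissonKernel {μ : Measure ℝ} (hμ : Integrable (fun t : ℝ => (1 + t ^ 2)⁻¹) μ)
    (x : ℝ) {y : ℝ} (hy : 0 < y) : Integrable (fun t => y / ((t - x) ^ 2 + y ^ 2)) μ := by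
  refine (hμ.const_mul (2 * y + (1 + 2 * x ^ 2) / y)).mono'
    (Measurable.aestronglyMeasurable (by fun_prop)) ?_
  refine ae_of_all _ fun t => ?_
  rw [Real.norm_of_nonneg (poissonKernel_nonneg t x hy)]
  exact poissonKernel_le t x hy

/-- Substitution `x = t + y s`. The weight no longer depends on `y`, so limits as `y → 0` only
concern `φ`. -/
theorem integral_mul_poissonKernel_eq (φ : ℝ → ℝ) (t : ℝ) {y : ℝ} (hy : 0 < y) :
    ∫ x, φ x * (y / ((t - x) ^ 2 + y ^ 2)) = ∫ s, φ (t + y * s) * (1 + s ^ 2)⁻¹ := by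
  have h1 := integral_add_left_eq_self (μ := volume)
    (fun x => φ x * (y / ((t - x) ^ 2 + y ^ 2))) t
  have h2 := Measure.integral_comp_mul_left
    (fun x => φ (t + x) * (y / ((t - (t + x)) ^ 2 + y ^ 2))) y
  rw [← h1]
  have h3 : ∫ x, φ (t + x) * (y / ((t - (t + x)) ^ 2 + y ^ 2)) =
      y * ∫ s, φ (t + y * s) * (y / ((t - (t + y * s)) ^ 2 + y ^ 2)) := by
    rw [h2, abs_of_pos (inv_pos.2 hy), smul_eq_mul, ← mul_assoc, mul_inv_cancel₀ hy.ne', one_mul]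
  rw [h3, ← integral_const_mul]
  congr 1
  ext s
  have : (t - (t + y * s)) ^ 2 + y ^ 2 = y ^ 2 * (1 + s ^ 2) := by ring
  rw [this]
  have : 1 + s ^ 2 ≠ 0 := by positivity
  field_simp

theorem integral_poissonKernel (x : ℝ) {y : ℝ} (hy : 0 < y) :
    ∫ t : ℝ, y / ((t - x) ^ 2 + y ^ 2) = Real.pi := by
  have h := integral_mul_poissonKernel_eq (fun _ => 1) x hy
  simp only [one_mul, integral_univ_inv_one_add_sq] at h
  rw [← h]
  congr 1
  ext t
  congr 2
  ring

variable {φ : ℝ → ℝ}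

theorem integrable_mul_inv_one_add_sq (hφ : Continuous φ) (hc : HasCompactSupport φ) (t y : ℝ) :
    Integrable (fun s => φ (t + y * s) * (1 + s ^ 2)⁻¹) := by
  obtain ⟨M, hM⟩ := hc.exists_bound_of_continuous hφ
  refine integrable_inv_one_add_sq.bdd_mul (c := M) (by fun_prop) ?_
  exact ae_of_all _ fun s => hM _

/-- The Poisson integral of a test function decays like `(1 + t ^ 2)⁻¹`, uniformly in the height. -/
theorem exists_abs_integral_mul_poissonKernel_le (hφ : Continuous φ) (hc : HasCompactSupport φ) :
    ∃ A : ℝ, ∀ y : ℝ, 0 < y → y ≤ 1 → ∀ t : ℝ,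
      |∫ x, φ x * (y / ((t - x) ^ 2 + y ^ 2))| ≤ A * (1 + t ^ 2)⁻¹ := by
  have hc' : HasCompactSupport fun x => φ x * (2 * (1 + x ^ 2)) := hc.mul_right
  obtain ⟨M, hM⟩ := hc'.exists_bound_of_continuous (by fun_prop)
  have hint : Integrable φ := hφ.integrable_of_hasCompactSupport hc
  refine ⟨M * Real.pi + 2 * ∫ x, |φ x|, fun y hy hy1 t => ?_⟩
  have ht : 0 < 1 + t ^ 2 := by positivity
  rw [← div_eq_mul_inv, le_div_iff₀ ht, integral_mul_poissonKernel_eq _ _ hy]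
  have hsub : ∫ s, |φ (t + y * s)| = y⁻¹ * ∫ x, |φ x| := by
    rw [Measure.integral_comp_mul_left (fun x => |φ (t + x)|) y, abs_of_pos (inv_pos.2 hy),
      smul_eq_mul, integral_add_left_eq_self (μ := volume) (fun x => |φ x|) t]
  have hintabs : Integrable fun s => |φ (t + y * s)| := by
    have := ((hint.comp_add_left t).comp_mul_left' hy.ne').abs
    exact this
  calc |∫ s, φ (t + y * s) * (1 + s ^ 2)⁻¹| * (1 + t ^ 2)
      ≤ (∫ s, |φ (t + y * s) * (1 + s ^ 2)⁻¹|) * (1 + t ^ 2) := by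
        gcongr
        exact abs_integral_le_integral_abs
    _ = ∫ s, |φ (t + y * s) * (1 + s ^ 2)⁻¹| * (1 + t ^ 2) := (integral_mul_const _ _).symm
    _ ≤ ∫ s, (M * (1 + s ^ 2)⁻¹ + 2 * y ^ 2 * |φ (t + y * s)|) := by
        refine integral_mono ((integrable_mul_inv_one_add_sq hφ hc t y).abs.mul_const _)
          ((integrable_inv_one_add_sq.const_mul M).add (hintabs.const_mul _)) fun s => ?_
        have hs : 0 < 1 + s ^ 2 := by positivity
        have hMs := hM (t + y * s)
        rw [Real.norm_eq_abs, abs_mul, abs_of_pos (by positivity : 0 < 2 * (1 + (t + y * s) ^ 2))]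
          at hMs
        -- Split `t = (t + y s) - y s`: against `φ` the first part is bounded by compact support,
        -- while `s²` in the second is absorbed by the weight `(1 + s²)⁻¹`.
        have h1 : 1 + t ^ 2 ≤ 2 * (1 + (t + y * s) ^ 2) + 2 * y ^ 2 * s ^ 2 := by
          nlinarith [sq_nonneg (t + 2 * (y * s))]
        simp only [abs_mul, abs_of_pos (inv_pos.2 hs)]
        have h2 : |φ (t + y * s)| * (1 + t ^ 2) ≤
            M + 2 * y ^ 2 * |φ (t + y * s)| * (1 + s ^ 2) := by
          calc |φ (t + y * s)| * (1 + t ^ 2)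
              ≤ |φ (t + y * s)| * (2 * (1 + (t + y * s) ^ 2) + 2 * y ^ 2 * s ^ 2) := by gcongr
            _ = |φ (t + y * s)| * (2 * (1 + (t + y * s) ^ 2)) +
                2 * y ^ 2 * |φ (t + y * s)| * s ^ 2 := by ring
            _ ≤ _ := by gcongr; linarith
        calc |φ (t + y * s)| * (1 + s ^ 2)⁻¹ * (1 + t ^ 2)
            = (|φ (t + y * s)| * (1 + t ^ 2)) * (1 + s ^ 2)⁻¹ := by ring
          _ ≤ (M + 2 * y ^ 2 * |φ (t + y * s)| * (1 + s ^ 2)) * (1 + s ^ 2)⁻¹ := by gcongr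
          _ = _ := by field_simp
    _ = M * Real.pi + 2 * y * ∫ x, |φ x| := by
        rw [integral_add (integrable_inv_one_add_sq.const_mul M) (hintabs.const_mul _),
          integral_const_mul, integral_const_mul, integral_univ_inv_one_add_sq, hsub]
        field_simp
    _ ≤ M * Real.pi + 2 * ∫ x, |φ x| := by
        have : 0 ≤ ∫ x, |φ x| := integral_nonneg fun x => abs_nonneg _
        nlinarith

theorem tendsto_integral_mul_poissonKernel (hφ : Continuous φ) (hc : HasCompactSupport φ) (t : ℝ) :
    Tendsto (fun y : ℝ => ∫ x, φ x * (y / ((t - x) ^ 2 + y ^ 2))) (𝓝[>] 0)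
      (𝓝 (Real.pi * φ t)) := by
  obtain ⟨M, hM⟩ := hc.exists_bound_of_continuous hφ
  have h : Tendsto (fun y : ℝ => ∫ s, φ (t + y * s) * (1 + s ^ 2)⁻¹) (𝓝[>] 0)
      (𝓝 (∫ s : ℝ, φ t * (1 + s ^ 2)⁻¹)) := by
    refine tendsto_integral_filter_of_dominated_convergence (fun s => M * (1 + s ^ 2)⁻¹)
      (Eventually.of_forall fun y => (integrable_mul_inv_one_add_sq hφ hc t y).1) ?_
      (integrable_inv_one_add_sq.const_mul M) ?_
    · refine Eventually.of_forall fun y => ae_of_all _ fun s => ?_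
      rw [norm_mul, Real.norm_of_nonneg (by positivity : 0 ≤ (1 + s ^ 2)⁻¹)]
      gcongr
      exact hM _
    · refine ae_of_all _ fun s => ?_
      have : Continuous fun y : ℝ => φ (t + y * s) * (1 + s ^ 2)⁻¹ := by fun_prop
      simpa using (this.tendsto 0).mono_left nhdsWithin_le_nhds
  rw [integral_const_mul, integral_univ_inv_one_add_sq, mul_comm] at h
  refine h.congr' ?_
  filter_upwards [self_mem_nhdsWithin] with y hy
  exact (integral_mul_poissonKernel_eq φ t hy).symm

theorem integrable_prod_poissonKernel {μ : Measure ℝ} [IsLocallyFiniteMeasure μ]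
    (hμ : Integrable (fun t : ℝ => (1 + t ^ 2)⁻¹) μ)
    (hφ : Continuous φ) (hc : HasCompactSupport φ) {y : ℝ} (hy : 0 < y) :
    Integrable (Function.uncurry fun x t : ℝ => φ x * (y / ((t - x) ^ 2 + y ^ 2)))
      (volume.prod μ) := by
  have h1 : Integrable fun x => |φ x| * (2 * y + (1 + 2 * x ^ 2) / y) := by
    refine Continuous.integrable_of_hasCompactSupport (by fun_prop) ?_
    exact HasCompactSupport.mul_right (hc.comp_left (g := fun x : ℝ => |x|) abs_zero)
  refine (h1.mul_prod hμ).mono' ?_ (ae_of_all _ fun p => ?_)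
  · exact Measurable.aestronglyMeasurable (by unfold Function.uncurry; fun_prop)
  · simp only [Function.uncurry, norm_mul, Real.norm_eq_abs,
      abs_of_nonneg (poissonKernel_nonneg p.2 p.1 hy), mul_assoc]
    gcongr
    exact poissonKernel_le _ _ hy

/-- Stieltjes inversion. -/
theorem tendsto_integral_mul_poissonIntegral {μ : Measure ℝ} [IsLocallyFiniteMeasure μ]
    (hμ : Integrable (fun t : ℝ => (1 + t ^ 2)⁻¹) μ)
    (hφ : Continuous φ) (hc : HasCompactSupport φ) :
    Tendsto (fun y : ℝ => ∫ x, φ x * ∫ t, y / ((t - x) ^ 2 + y ^ 2) ∂μ) (𝓝[>] 0)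
      (𝓝 (Real.pi * ∫ t, φ t ∂μ)) := by
  -- Fubini moves the Poisson kernel from `μ` onto `φ`, where it is an approximate identity of mass
  -- `π`. As `μ` may be infinite, domination needs the decay `A (1 + t²)⁻¹`, uniform for `y ≤ 1`.
  obtain ⟨A, hA⟩ := exists_abs_integral_mul_poissonKernel_le hφ hc
  have hle : ∀ᶠ y : ℝ in 𝓝[>] 0, 0 < y ∧ y ≤ 1 := by
    filter_upwards [Ioc_mem_nhdsGT one_pos] with y hy using hy
  have h : Tendsto (fun y : ℝ => ∫ t, (∫ x, φ x * (y / ((t - x) ^ 2 + y ^ 2))) ∂μ) (𝓝[>] 0)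
      (𝓝 (∫ t, Real.pi * φ t ∂μ)) := by
    refine tendsto_integral_filter_of_dominated_convergence (fun t => A * (1 + t ^ 2)⁻¹) ?_ ?_
      (hμ.const_mul A) (ae_of_all _ fun t => tendsto_integral_mul_poissonKernel hφ hc t)
    · filter_upwards [hle] with y hy
      exact (integrable_prod_poissonKernel hμ hφ hc hy.1).integral_prod_right.1
    · filter_upwards [hle] with y hy
      exact ae_of_all _ fun t => hA y hy.1 hy.2 t
  rw [integral_const_mul] at h
  refine h.congr' ?_
  filter_upwards [hle] with y hy
  rw [← integral_integral_swap (integrable_prod_poissonKernel hμ hφ hc hy.1)]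
  simp only [integral_const_mul]

theorem integrable_inv_one_add_sq_add_smul_volume {μ : Measure ℝ}
    (hμ : Integrable (fun t : ℝ => (1 + t ^ 2)⁻¹) μ) (a : NNReal) :
    Integrable (fun t : ℝ => (1 + t ^ 2)⁻¹) (μ + a • volume) :=
  hμ.add_measure (integrable_inv_one_add_sq.smul_measure_nnreal)

theorem poissonIntegral_add_smul_volume {μ : Measure ℝ}
    (hμ : Integrable (fun t : ℝ => (1 + t ^ 2)⁻¹) μ) (a : NNReal) (x : ℝ) {y : ℝ} (hy : 0 < y) :
    ∫ t, y / ((t - x) ^ 2 + y ^ 2) ∂(μ + a • volume) =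
      ∫ t, y / ((t - x) ^ 2 + y ^ 2) ∂μ + a * Real.pi := by
  rw [integral_add_measure (integrable_poissonKernel hμ x hy)
    ((integrable_poissonKernel integrable_inv_one_add_sq x hy).smul_measure_nnreal),
    integral_smul_nnreal_measure, integral_poissonKernel x hy]
  rfl

/-- A measure is determined by its Poisson integral, up to a linear term. -/
theorem measure_eq_of_poissonIntegral_eq {μ ν : Measure ℝ}
    [IsLocallyFiniteMeasure μ] [IsLocallyFiniteMeasure ν]
    (hμ : Integrable (fun t : ℝ => (1 + t ^ 2)⁻¹) μ)
    (hν : Integrable (fun t : ℝ => (1 + t ^ 2)⁻¹) ν) {d : ℝ}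
    (h : ∀ x y : ℝ, 0 < y → ∫ t, y / ((t - x) ^ 2 + y ^ 2) ∂μ =
      ∫ t, y / ((t - x) ^ 2 + y ^ 2) ∂ν + d * y) : μ = ν := by
  refine Measure.ext_of_integral_eq_on_compactlySupported fun f => ?_
  have hf : Continuous f := f.continuous
  have hc := f.hasCompactSupport
  have h1 := tendsto_integral_mul_poissonIntegral hμ hf hc
  have h2 := tendsto_integral_mul_poissonIntegral hν hf hc
  have h3 : Tendsto (fun y : ℝ => (d * y) * ∫ x, f x) (𝓝[>] 0) (𝓝 0) := by
    have : Continuous fun y : ℝ => (d * y) * ∫ x, f x := by fun_prop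
    simpa using (this.tendsto 0).mono_left nhdsWithin_le_nhds
  have h4 := h2.add h3
  rw [add_zero] at h4
  refine mul_left_cancel₀ Real.pi_ne_zero (tendsto_nhds_unique (h1.congr' ?_) h4)
  filter_upwards [self_mem_nhdsWithin] with y hy
  have hi : Integrable (fun x => f x * ∫ t, y / ((t - x) ^ 2 + y ^ 2) ∂ν) := by
    have := (integrable_prod_poissonKernel hν hf hc hy).integral_prod_left
    simpa only [Function.uncurry, integral_const_mul] using this
  rw [mul_comm (d * y), ← integral_mul_const, ← integral_add hi
    ((hf.integrable_of_hasCompactSupport hc).mul_const _)]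
  congr 1
  ext x
  rw [h x y hy]
  ring

theorem measure_and_coeff_eq_of_poissonIntegral_eq {μ ν : Measure ℝ}
    [IsLocallyFiniteMeasure μ] [IsLocallyFiniteMeasure ν]
    (hμ : Integrable (fun t : ℝ => (1 + t ^ 2)⁻¹) μ)
    (hν : Integrable (fun t : ℝ => (1 + t ^ 2)⁻¹) ν) {d J : ℝ}
    (h : ∀ x y : ℝ, 0 < y → ∫ t, y / ((t - x) ^ 2 + y ^ 2) ∂μ =
      ∫ t, y / ((t - x) ^ 2 + y ^ 2) ∂ν + d * y + J) :
    d = 0 ∧ ∀ s : Set ℝ, μ s ≠ ⊤ → ν s ≠ ⊤ → volume s ≠ ⊤ →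
      μ.real s = ν.real s + J / Real.pi * volume.real s := by
  -- `J` may be negative, so its positive and negative parts are added as Lebesgue terms on opposite
  -- sides, keeping both measures positive.
  obtain ⟨a, b, hab⟩ : ∃ a b : NNReal, J = (a - b) * Real.pi := by
    refine ⟨(J / Real.pi).toNNReal, (-(J / Real.pi)).toNNReal, ?_⟩
    have : ((J / Real.pi).toNNReal : ℝ) - ((-(J / Real.pi)).toNNReal : ℝ) = J / Real.pi := by
      simp only [Real.coe_toNNReal']
      exact max_zero_sub_eq_self _
    rw [this, div_mul_cancel₀ _ Real.pi_ne_zero]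
  have hP : ∀ x y : ℝ, 0 < y → ∫ t, y / ((t - x) ^ 2 + y ^ 2) ∂(μ + b • volume) =
      ∫ t, y / ((t - x) ^ 2 + y ^ 2) ∂(ν + a • volume) + d * y := by
    intro x y hy
    rw [poissonIntegral_add_smul_volume hμ b x hy, poissonIntegral_add_smul_volume hν a x hy,
      h x y hy, hab]
    ring
  have heq : μ + b • volume = ν + a • volume := measure_eq_of_poissonIntegral_eq
    (integrable_inv_one_add_sq_add_smul_volume hμ b)
    (integrable_inv_one_add_sq_add_smul_volume hν a) hP
  refine ⟨?_, fun s hμs hνs hs => ?_⟩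
  -- Once the measures coincide, the Poisson integrals cancel and `d * 1 = 0` remains.
  · have := hP 0 1 one_pos
    rw [heq] at this
    linarith
  · have := congrArg (fun m : Measure ℝ => m.real s) heq
    simp only [Measure.real, Measure.add_apply, Measure.smul_apply] at this
    rw [ENNReal.toReal_add hμs (by simpa [ENNReal.smul_def] using ENNReal.mul_ne_top ENNReal.coe_ne_top hs),
      ENNReal.toReal_add hνs (by simpa [ENNReal.smul_def] using ENNReal.mul_ne_top ENNReal.coe_ne_top hs)] at this
    simp only [ENNReal.smul_def, smul_eq_mul, ENNReal.toReal_mul, ENNReal.coe_toReal] at this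
    rw [hab, mul_div_assoc, div_self Real.pi_ne_zero, mul_one]
    simp only [Measure.real]
    linarith

end Poisson

/-! ### Scalar measures attached to an operator measure. -/

section ScalarMeasure

variable {H : Type*} [NormedAddCommGroup H] [InnerProductSpace ℂ H]
  {S : Set ℝ → (H →L[ℂ] H)}

theorem BoundedBorel.inter_right {δ ε : Set ℝ} (hδ : δ ∈ BoundedBorel) (hε : MeasurableSet ε) :
    δ ∩ ε ∈ BoundedBorel :=
  ⟨hδ.1.inter hε, hδ.2.subset inter_subset_left⟩

theorem IsOperatorMeasure.re_inner_nonneg (hS : IsOperatorMeasure S) (h : H) {δ : Set ℝ}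
    (hδ : δ ∈ BoundedBorel) : 0 ≤ (inner ℂ h (S δ h)).re :=
  (Complex.nonneg_iff.1 ((hS.nonneg δ hδ).inner_nonneg_right h)).1

theorem coe_re_inner_of_isPositive {T : H →L[ℂ] H} (hT : T.IsPositive) (h : H) :
    (((inner ℂ h (T h)).re : ℝ) : ℂ) = inner ℂ h (T h) :=
  Complex.ext rfl (Complex.nonneg_iff.1 (hT.inner_nonneg_right h)).2

theorem IsOperatorMeasure.hasSum_re_inner (hS : IsOperatorMeasure S) (h : H) {δ : ℕ → Set ℝ}
    (hδ : ∀ n, δ n ∈ BoundedBorel) (hd : Pairwise (Function.onFun Disjoint δ))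
    (hU : (⋃ n, δ n) ∈ BoundedBorel) :
    HasSum (fun n => (inner ℂ h (S (δ n) h)).re) (inner ℂ h (S (⋃ n, δ n) h)).re :=
  Complex.hasSum_re ((hS.hasSum δ hδ hd hU h).mapL (innerSL ℂ h))

theorem IsOperatorMeasure.ofReal_re_inner_iUnion (hS : IsOperatorMeasure S) (h : H)
    {δ : ℕ → Set ℝ} (hδ : ∀ n, δ n ∈ BoundedBorel) (hd : Pairwise (Function.onFun Disjoint δ))
    (hU : (⋃ n, δ n) ∈ BoundedBorel) :
    ENNReal.ofReal (inner ℂ h (S (⋃ n, δ n) h)).re =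
      ∑' n, ENNReal.ofReal (inner ℂ h (S (δ n) h)).re := by
  have hs := hS.hasSum_re_inner h hδ hd hU
  rw [← hs.tsum_eq, ENNReal.ofReal_tsum_of_nonneg (fun n => hS.re_inner_nonneg h (hδ n))
    hs.summable]

/-- The scalar measure `δ ↦ ⟪h, S δ h⟫` on a bounded interval. -/
theorem IsOperatorMeasure.exists_measure_inter (hS : IsOperatorMeasure S) (h : H) {ε : Set ℝ}
    (hε : ε ∈ BoundedBorel) :
    ∃ μ : Measure ℝ, ∀ δ, MeasurableSet δ →
      μ δ = ENNReal.ofReal (inner ℂ h (S (δ ∩ ε) h)).re := by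
  have hB : ∀ {δ : Set ℝ}, MeasurableSet δ → δ ∩ ε ∈ BoundedBorel := fun hδ => by
    rw [inter_comm]; exact BoundedBorel.inter_right hε hδ
  refine ⟨Measure.ofMeasurable (fun δ _ => ENNReal.ofReal (inner ℂ h (S (δ ∩ ε) h)).re)
    (by simp [hS.empty]) ?_, fun δ hδ => Measure.ofMeasurable_apply δ hδ⟩
  intro δ hδ hd
  have hU := hB (MeasurableSet.iUnion hδ)
  rw [iUnion_inter] at hU ⊢
  exact hS.ofReal_re_inner_iUnion h (fun n => hB (hδ n))
    (fun i j hij => (hd hij).mono inter_subset_left inter_subset_left) hU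

/-- `S` is only meaningful on bounded sets, so the measure is glued from its pieces on the unit
intervals `(n, n + 1]`. -/
theorem IsOperatorMeasure.exists_scalar_measure (hS : IsOperatorMeasure S) (h : H) :
    ∃ μ : Measure ℝ, IsLocallyFiniteMeasure μ ∧
      ∀ δ ∈ BoundedBorel, μ δ = ENNReal.ofReal (inner ℂ h (S δ h)).re := by
  let I : ℕ → Set ℝ := fun n => Ioc ((Equiv.intEquivNat.symm n : ℤ) : ℝ)
    ((Equiv.intEquivNat.symm n : ℤ) + 1)
  have hI : ∀ n, I n ∈ BoundedBorel := fun n => ⟨measurableSet_Ioc, Metric.isBounded_Ioc _ _⟩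
  have hd : Pairwise (Function.onFun Disjoint I) := by
    intro i j hij
    exact pairwise_disjoint_Ioc_intCast ℝ
      (fun h => hij (Equiv.intEquivNat.symm.injective h))
  have hU : ⋃ n, I n = univ := by
    have := iUnion_Ioc_intCast ℝ
    rw [← this]
    exact Equiv.intEquivNat.symm.surjective.iUnion_comp (fun n : ℤ => Ioc (n : ℝ) (n + 1))
  choose μ hμ using fun n => hS.exists_measure_inter h (hI n)
  have key : ∀ δ ∈ BoundedBorel, Measure.sum μ δ = ENNReal.ofReal (inner ℂ h (S δ h)).re := by
    intro δ hδ
    have hδU : ⋃ n, δ ∩ I n = δ := by rw [← inter_iUnion, hU, inter_univ]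
    rw [Measure.sum_apply _ hδ.1]
    simp only [hμ _ δ hδ.1]
    rw [← hS.ofReal_re_inner_iUnion h (fun n => BoundedBorel.inter_right hδ (hI n).1)
      (fun i j hij => (hd hij).mono inter_subset_right inter_subset_right) (by rwa [hδU]), hδU]
  refine ⟨Measure.sum μ, ⟨fun x => ⟨Icc (x - 1) (x + 1), Icc_mem_nhds (by linarith) (by linarith),
    ?_⟩⟩, key⟩
  rw [key _ ⟨measurableSet_Icc, Metric.isBounded_Icc _ _⟩]
  exact ENNReal.ofReal_lt_top

end ScalarMeasure

/-! ### Strong operator integrals as Lebesgue integrals of quadratic forms. -/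

section ScalarIntegral

variable {H : Type*} [NormedAddCommGroup H] [InnerProductSpace ℂ H]
  {S : Set ℝ → (H →L[ℂ] H)} {μ : Measure ℝ} {h : H} {f : ℝ → ℂ}

theorem inner_eq_measureReal (hS : IsOperatorMeasure S)
    (hμ : ∀ δ ∈ BoundedBorel, μ δ = ENNReal.ofReal (inner ℂ h (S δ h)).re) {δ : Set ℝ}
    (hδ : δ ∈ BoundedBorel) : inner ℂ h (S δ h) = (μ.real δ : ℂ) := by
  rw [Measure.real, hμ δ hδ, ENNReal.toReal_ofReal (hS.re_inner_nonneg h hδ),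
    coe_re_inner_of_isPositive (hS.nonneg δ hδ)]

theorem inner_simpleIntegral [IsLocallyFiniteMeasure μ] (hS : IsOperatorMeasure S)
    (hμ : ∀ δ ∈ BoundedBorel, μ δ = ENNReal.ofReal (inner ℂ h (S δ h)).re)
    (φ : SimpleFunc ℝ ℂ) (a b : ℝ) :
    inner ℂ h (simpleIntegral S φ (Icc a b) h) = ∫ t in Icc a b, φ t ∂μ := by
  have : IsFiniteMeasure (μ.restrict (Icc a b)) :=
    ⟨by rw [Measure.restrict_apply_univ]; exact isCompact_Icc.measure_lt_top⟩
  rw [← SimpleFunc.integral_eq_integral φ (SimpleFunc.integrable_of_isFiniteMeasure φ),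
    SimpleFunc.integral_eq, simpleIntegral, sum_apply, inner_sum]
  refine Finset.sum_congr rfl fun c _ => ?_
  have hc : φ ⁻¹' {c} ∩ Icc a b ∈ BoundedBorel :=
    ⟨(φ.measurableSet_fiber c).inter measurableSet_Icc,
      (Metric.isBounded_Icc a b).subset inter_subset_right⟩
  rw [smul_apply, inner_smul_right, inner_eq_measureReal hS hμ hc,
    measureReal_restrict_apply (φ.measurableSet_fiber c), Complex.real_smul, mul_comm]

/-- The interval has finite measure, so uniform approximation permits dominated convergence with
`‖f‖ + 1`. In particular the choice of simple functions is immaterial. -/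
theorem HasIntegralOn.inner_eq [IsLocallyFiniteMeasure μ] (hS : IsOperatorMeasure S)
    (hμ : ∀ δ ∈ BoundedBorel, μ δ = ENNReal.ofReal (inner ℂ h (S δ h)).re)
    (hf : Continuous f) {a b : ℝ} {T : H →L[ℂ] H} (hT : HasIntegralOn S f (Icc a b) T) :
    inner ℂ h (T h) = ∫ t in Icc a b, f t ∂μ := by
  obtain ⟨φ, hφ, hφT⟩ := hT
  have h1 : Tendsto (fun n => inner ℂ h (simpleIntegral S (φ n) (Icc a b) h)) atTop
      (𝓝 (inner ℂ h (T h))) := tendsto_const_nhds.inner (hφT h)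
  simp only [inner_simpleIntegral hS hμ] at h1
  refine tendsto_nhds_unique h1 (tendsto_integral_filter_of_dominated_convergence
    (fun t => ‖f t‖ + 1) (Eventually.of_forall fun n => (φ n).aestronglyMeasurable) ?_
    (by fun_prop : Continuous fun t => ‖f t‖ + 1).continuousOn.integrableOn_Icc ?_)
  · filter_upwards [Metric.tendstoUniformlyOn_iff.1 hφ 1 one_pos] with n hn
    filter_upwards [ae_restrict_mem measurableSet_Icc] with t ht
    have := hn t ht
    rw [dist_eq_norm] at this
    have h2 := norm_sub_norm_le (φ n t) (f t)
    rw [norm_sub_rev] at h2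
    linarith
  · filter_upwards [ae_restrict_mem measurableSet_Icc] with t ht
    exact hφ.tendsto_at ht

/-- Integrability of `f` is not presupposed: for the nonnegative weight `(1 + t²)⁻¹` it is deduced
from this convergence. -/
theorem HasStrongIntegral.tendsto_integral_Icc [IsLocallyFiniteMeasure μ]
    (hS : IsOperatorMeasure S)
    (hμ : ∀ δ ∈ BoundedBorel, μ δ = ENNReal.ofReal (inner ℂ h (S δ h)).re)
    (hf : Continuous f) {T : H →L[ℂ] H} (hT : HasStrongIntegral S f T) :
    Tendsto (fun p : ℝ × ℝ => ∫ t in Icc p.1 p.2, f t ∂μ) (atBot ×ˢ atTop)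
      (𝓝 (inner ℂ h (T h))) := by
  obtain ⟨I, hI, hIT⟩ := hT
  have h1 : Tendsto (fun p : ℝ × ℝ => inner ℂ h (I p.1 p.2 h)) (atBot ×ˢ atTop)
      (𝓝 (inner ℂ h (T h))) := tendsto_const_nhds.inner (hIT h)
  refine h1.congr fun p => ?_
  exact (hI p.1 p.2).inner_eq hS hμ hf

theorem aecover_Icc_prod : AECover μ (atBot ×ˢ atTop) fun p : ℝ × ℝ => Icc p.1 p.2 :=
  aecover_Icc tendsto_fst tendsto_snd

theorem HasStrongIntegral.inner_eq [IsLocallyFiniteMeasure μ] (hS : IsOperatorMeasure S)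
    (hμ : ∀ δ ∈ BoundedBorel, μ δ = ENNReal.ofReal (inner ℂ h (S δ h)).re)
    (hf : Continuous f) (hfi : Integrable f μ) {T : H →L[ℂ] H} (hT : HasStrongIntegral S f T) :
    inner ℂ h (T h) = ∫ t, f t ∂μ :=
  tendsto_nhds_unique (hT.tendsto_integral_Icc hS hμ hf)
    (aecover_Icc_prod.integral_tendsto_of_countably_generated hfi)

theorem integrable_inv_one_add_sq_of_hasStrongIntegral [IsLocallyFiniteMeasure μ]
    (hS : IsOperatorMeasure S)
    (hμ : ∀ δ ∈ BoundedBorel, μ δ = ENNReal.ofReal (inner ℂ h (S δ h)).re)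
    {T : H →L[ℂ] H} (hT : HasStrongIntegral S (fun t => 1 / (1 + (t : ℂ) ^ 2)) T) :
    Integrable (fun t : ℝ => (1 + t ^ 2)⁻¹) μ := by
  have hcast : (fun t : ℝ => 1 / (1 + (t : ℂ) ^ 2)) = fun t : ℝ => (((1 + t ^ 2)⁻¹ : ℝ) : ℂ) := by
    ext t
    push_cast
    rw [one_div]
  have hcont : Continuous fun t : ℝ => (1 + t ^ 2)⁻¹ :=
    Continuous.inv₀ (by fun_prop) fun t => by positivity
  rw [hcast] at hT
  have h1 := hT.tendsto_integral_Icc hS hμ (Complex.continuous_ofReal.comp hcont)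
  simp only [Function.comp_def, integral_complex_ofReal] at h1
  have h2 := (Complex.continuous_re.tendsto _).comp h1
  simp only [Function.comp_def, Complex.ofReal_re] at h2
  exact aecover_Icc_prod.integrable_of_integral_tendsto_of_nonneg_ae _
    (fun p => hcont.continuousOn.integrableOn_Icc) (ae_of_all _ fun t => by positivity) h2

end ScalarIntegral

/-! ### The Nevanlinna kernel. -/

section Kernel

theorem ofReal_sub_ne_zero (t : ℝ) {z : ℂ} (hz : z.im ≠ 0) : (t : ℂ) - z ≠ 0 := fun h => by
  have := congrArg Complex.im h
  simp at this
  exact hz this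

theorem one_add_ofReal_sq_ne_zero (t : ℝ) : 1 + (t : ℂ) ^ 2 ≠ 0 := by
  have : (1 + t ^ 2 : ℝ) ≠ 0 := by positivity
  exact_mod_cast this

/-- The first factor is bounded in `t` because `|t - z| ≥ |Im z|`, whence integrability; at `z = i`
it reduces to `i`, so the kernel is purely imaginary there. -/
theorem nevanlinnaKernel_eq (t : ℝ) {z : ℂ} (hz : z.im ≠ 0) :
    1 / ((t : ℂ) - z) - (t : ℂ) / (1 + (t : ℂ) ^ 2) =
      (z + (1 + z ^ 2) / ((t : ℂ) - z)) * (((1 + t ^ 2)⁻¹ : ℝ) : ℂ) := by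
  have h1 := ofReal_sub_ne_zero t hz
  have h2 := one_add_ofReal_sq_ne_zero t
  push_cast
  field_simp
  ring

theorem continuous_nevanlinnaKernel {z : ℂ} (hz : z.im ≠ 0) :
    Continuous fun t : ℝ => 1 / ((t : ℂ) - z) - (t : ℂ) / (1 + (t : ℂ) ^ 2) := by
  refine (continuous_const.div (by fun_prop) fun t => ofReal_sub_ne_zero t hz).sub
    (Complex.continuous_ofReal.div (by fun_prop) one_add_ofReal_sq_ne_zero)

theorem integrable_nevanlinnaKernel {μ : Measure ℝ}
    (hμ : Integrable (fun t : ℝ => (1 + t ^ 2)⁻¹) μ) {z : ℂ} (hz : z.im ≠ 0) :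
    Integrable (fun t : ℝ => 1 / ((t : ℂ) - z) - (t : ℂ) / (1 + (t : ℂ) ^ 2)) μ := by
  refine (hμ.const_mul (‖z‖ + ‖1 + z ^ 2‖ / |z.im|)).mono'
    (continuous_nevanlinnaKernel hz).aestronglyMeasurable (ae_of_all _ fun t => ?_)
  rw [nevanlinnaKernel_eq t hz, norm_mul, Complex.norm_real,
    Real.norm_of_nonneg (by positivity : 0 ≤ (1 + t ^ 2)⁻¹)]
  gcongr
  refine (norm_add_le _ _).trans ?_
  rw [norm_div]
  have : |z.im| ≤ ‖(t : ℂ) - z‖ := by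
    have := Complex.abs_im_le_norm ((t : ℂ) - z)
    simpa using this
  gcongr

theorem im_nevanlinnaKernel (t : ℝ) (z : ℂ) :
    (1 / ((t : ℂ) - z) - (t : ℂ) / (1 + (t : ℂ) ^ 2)).im =
      z.im / ((t - z.re) ^ 2 + z.im ^ 2) := by
  have h : (t : ℂ) / (1 + (t : ℂ) ^ 2) = ((t / (1 + t ^ 2) : ℝ) : ℂ) := by push_cast; rfl
  rw [h, Complex.sub_im, Complex.ofReal_im, sub_zero, one_div, Complex.inv_im, Complex.normSq_apply]
  simp
  congr 1
  ring

theorem re_nevanlinnaKernel_I (t : ℝ) :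
    (1 / ((t : ℂ) - Complex.I) - (t : ℂ) / (1 + (t : ℂ) ^ 2)).re = 0 := by
  have h : 1 + Complex.I ^ 2 = 0 := by rw [Complex.I_sq]; ring
  rw [nevanlinnaKernel_eq t (by simp), h, zero_div, add_zero, Complex.re_mul_ofReal, Complex.I_re,
    zero_mul]

end Kernel

/-! ### Scalar form of the integral representation. -/

section Representation

variable {H : Type*} [NormedAddCommGroup H] [InnerProductSpace ℂ H] [CompleteSpace H]
  {S : Set ℝ → (H →L[ℂ] H)} {F : ℂ → (H →L[ℂ] H)} {C D : H →L[ℂ] H}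

theorem im_inner_of_isSelfAdjoint {T : H →L[ℂ] H} (hT : IsSelfAdjoint T) (h : H) :
    (inner ℂ h (T h)).im = 0 := by
  have := hT.isSymmetric.coe_re_inner_self_apply h
  have := hT.isSymmetric.im_inner_self_apply h
  simpa using this

/-- The quadratic form of an operator Nevanlinna function. -/
theorem HasIntegralRepresentation.exists_scalar (hF : HasIntegralRepresentation F C D S) (h : H) :
    ∃ μ : Measure ℝ, IsLocallyFiniteMeasure μ ∧ Integrable (fun t : ℝ => (1 + t ^ 2)⁻¹) μ ∧
      (∀ δ ∈ BoundedBorel, μ δ ≠ ⊤ ∧ inner ℂ h (S δ h) = (μ.real δ : ℂ)) ∧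
      (∀ z : ℂ, 0 < z.im → (inner ℂ h (F z h)).im =
        ∫ t, z.im / ((t - z.re) ^ 2 + z.im ^ 2) ∂μ + (inner ℂ h (D h)).re * z.im) ∧
      (inner ℂ h (F Complex.I h)).re = (inner ℂ h (C h)).re := by
  obtain ⟨μ, hfin, hμ⟩ := hF.measure.exists_scalar_measure h
  obtain ⟨T₀, hT₀⟩ := hF.integrable
  have hint := integrable_inv_one_add_sq_of_hasStrongIntegral hF.measure hμ hT₀
  have hD := im_inner_of_isSelfAdjoint hF.nonneg_D.isSelfAdjoint h
  have hrep : ∀ z : ℂ, z.im ≠ 0 → inner ℂ h (F z h) = inner ℂ h (C h) + z * inner ℂ h (D h) +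
      ∫ t : ℝ, (1 / ((t : ℂ) - z) - (t : ℂ) / (1 + (t : ℂ) ^ 2)) ∂μ := by
    intro z hz
    obtain ⟨T, hT, hFz⟩ := hF.representation z hz
    rw [hFz, ← hT.inner_eq hF.measure hμ (continuous_nevanlinnaKernel hz)
      (integrable_nevanlinnaKernel hint hz)]
    simp only [add_apply, smul_apply, inner_add_right,
      inner_smul_right]
  refine ⟨μ, hfin, hint, fun δ hδ => ⟨?_, inner_eq_measureReal hF.measure hμ hδ⟩,
    fun z hz => ?_, ?_⟩
  · rw [hμ δ hδ]
    exact ENNReal.ofReal_ne_top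
  · have h1 := integral_im (𝕜 := ℂ) (integrable_nevanlinnaKernel hint hz.ne')
    simp only [RCLike.im_to_complex, im_nevanlinnaKernel] at h1
    rw [hrep z hz.ne', h1, Complex.add_im, Complex.add_im, Complex.mul_im,
      im_inner_of_isSelfAdjoint hF.selfAdjoint_C, hD]
    ring
  -- At `z = i` both the `D` term and the integral are purely imaginary, leaving `C` as the real
  -- part.
  · have hI : Complex.I.im ≠ 0 := by simp
    have h1 := integral_re (𝕜 := ℂ) (integrable_nevanlinnaKernel hint hI)
    simp only [RCLike.re_to_complex, re_nevanlinnaKernel_I, integral_zero] at h1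
    rw [hrep _ hI, Complex.add_re, Complex.add_re, Complex.mul_re, ← h1, hD]
    simp

end Representation

/-! ### Existence and comparison of Lebesgue decompositions. -/

section Decomposition

variable {H : Type*} [NormedAddCommGroup H] [InnerProductSpace ℂ H]
  {S : Set ℝ → (H →L[ℂ] H)}

/-- Complex polarization; no self-adjointness is needed. -/
theorem eq_of_inner_eq {T T' : H →L[ℂ] H} (hT : ∀ h, inner ℂ h (T h) = inner ℂ h (T' h)) :
    T = T' := by
  have : (T : H →ₗ[ℂ] H) = T' := by
    rw [← ext_inner_map]
    intro h
    have := congrArg (starRingEnd ℂ) (hT h)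
    rwa [inner_conj_symm, inner_conj_symm] at this
  exact ContinuousLinearMap.coe_injective this

theorem IsOperatorMeasure.inter_right (hS : IsOperatorMeasure S) {ε : Set ℝ}
    (hε : MeasurableSet ε) : IsOperatorMeasure fun δ => S (δ ∩ ε) where
  empty := by simp [hS.empty]
  nonneg δ hδ := hS.nonneg _ (BoundedBorel.inter_right hδ hε)
  hasSum δ hδ hd hU h := by
    have hU' := BoundedBorel.inter_right hU hε
    rw [iUnion_inter] at hU' ⊢
    exact hS.hasSum _ (fun n => BoundedBorel.inter_right (hδ n) hε)
      (fun i j hij => (hd hij).mono inter_subset_left inter_subset_left) hU' h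

theorem IsOperatorMeasure.add_compl (hS : IsOperatorMeasure S) {δ ε : Set ℝ}
    (hδ : δ ∈ BoundedBorel) (hε : MeasurableSet ε) : S δ = S (δ ∩ εᶜ) + S (δ ∩ ε) := by
  have hA := BoundedBorel.inter_right hδ hε
  have hB := BoundedBorel.inter_right hδ hε.compl
  refine eq_of_inner_eq fun h => ?_
  obtain ⟨μ, -, hμ⟩ := hS.exists_scalar_measure h
  have hfin : ∀ {s}, s ∈ BoundedBorel → μ s ≠ ⊤ := fun hs => by
    rw [hμ _ hs]
    exact ENNReal.ofReal_ne_top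
  rw [add_apply, inner_add_right, inner_eq_measureReal hS hμ hδ,
    inner_eq_measureReal hS hμ hA, inner_eq_measureReal hS hμ hB, ← Complex.ofReal_add,
    add_comm (μ.real (δ ∩ εᶜ)), ← sdiff_eq, measureReal_inter_add_sdiff hε (hfin hδ)]

/-- The null set carries the singular part of `μ`; off it only the part with a density remains. -/
theorem exists_null_set_of_measure (μ : Measure ℝ) [SFinite μ] :
    ∃ N : Set ℝ, MeasurableSet N ∧ volume N = 0 ∧ ∀ δ, volume δ = 0 → μ (δ ∩ Nᶜ) = 0 := by
  obtain ⟨N, hN, h1, h2⟩ := μ.mutuallySingular_singularPart (volume : Measure ℝ)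
  refine ⟨Nᶜ, hN.compl, h2, fun δ hδ => ?_⟩
  rw [compl_compl, μ.haveLebesgueDecomposition_add volume, Measure.add_apply]
  have h3 : μ.singularPart volume (δ ∩ N) = 0 := measure_mono_null inter_subset_right h1
  have h4 : (volume.withDensity (μ.rnDeriv volume)) (δ ∩ N) = 0 :=
    withDensity_absolutelyContinuous _ _ (measure_mono_null inter_subset_left hδ)
  rw [h3, h4, add_zero]

/-- Separability enters here: the exceptional null sets of countably many dense vectors have a null
union, and continuity of the quadratic form extends the vanishing to every vector. -/
theorem IsOperatorMeasure.exists_null_set [TopologicalSpace.SeparableSpace H]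
    (hS : IsOperatorMeasure S) :
    ∃ N : Set ℝ, MeasurableSet N ∧ volume N = 0 ∧ IsAC fun δ => S (δ ∩ Nᶜ) := by
  choose μ hfin hμ using fun h => hS.exists_scalar_measure h
  choose N hN hN0 hac using fun n : ℕ =>
    exists_null_set_of_measure (μ (TopologicalSpace.denseSeq H n))
  have hU := MeasurableSet.iUnion hN
  refine ⟨⋃ n, N n, hU, measure_iUnion_null hN0, fun δ hδ h0 => ?_⟩
  have hB := BoundedBorel.inter_right hδ hU.compl
  have hcont : Continuous fun h : H => inner ℂ h (S (δ ∩ (⋃ n, N n)ᶜ) h) := by fun_prop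
  have hzero : (fun h : H => inner ℂ h (S (δ ∩ (⋃ n, N n)ᶜ) h)) = fun _ => 0 := by
    refine hcont.ext_on (TopologicalSpace.denseRange_denseSeq H) continuous_const ?_
    rintro _ ⟨n, rfl⟩
    dsimp only
    rw [inner_eq_measureReal hS (hμ _) hB, Measure.real, measure_mono_null _ (hac n δ h0)]
    · simp
    · exact inter_subset_inter_right _ (compl_subset_compl.2 (subset_iUnion N n))
  refine eq_of_inner_eq fun h => ?_
  simpa using congrFun hzero h

theorem IsOperatorMeasure.exists_isLebesgueDecomposition [TopologicalSpace.SeparableSpace H]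
    (hS : IsOperatorMeasure S) : ∃ Sac Ss, IsLebesgueDecomposition S Sac Ss := by
  obtain ⟨N, hN, hN0, hac⟩ := hS.exists_null_set
  exact ⟨_, _, hS.inter_right hN.compl, hS.inter_right hN, fun δ hδ => hS.add_compl hδ hN, hac,
    N, hN, hN0, fun δ _ => by simp [inter_assoc]⟩

/-- The absolutely continuous part dies on `N'`. The freedom to enlarge the carrier lets two
decompositions use the same null set. -/
theorem IsLebesgueDecomposition.singular_eq {Sac Ss : Set ℝ → (H →L[ℂ] H)}
    (hS : IsLebesgueDecomposition S Sac Ss) {N N' : Set ℝ} (hN' : MeasurableSet N')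
    (hN'0 : volume N' = 0) (hNN' : N ⊆ N') (hs : ∀ δ ∈ BoundedBorel, Ss δ = Ss (δ ∩ N))
    {δ : Set ℝ} (hδ : δ ∈ BoundedBorel) : Ss δ = S (δ ∩ N') := by
  have hB := BoundedBorel.inter_right hδ hN'
  rw [hS.add _ hB, hS.ac _ hB (measure_mono_null inter_subset_right hN'0), zero_add, hs _ hB,
    inter_assoc, inter_eq_self_of_subset_right hNN', ← hs _ hδ]

/-- Operator measures that agree on Lebesgue null sets have the same singular part. -/
theorem IsLebesgueDecomposition.singular_eq_singular {S₁ S₂ Sac₁ Ss₁ Sac₂ Ss₂ : Set ℝ → (H →L[ℂ] H)}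
    (h₁ : IsLebesgueDecomposition S₁ Sac₁ Ss₁) (h₂ : IsLebesgueDecomposition S₂ Sac₂ Ss₂)
    (h : ∀ δ ∈ BoundedBorel, volume δ = 0 → S₁ δ = S₂ δ) {δ : Set ℝ} (hδ : δ ∈ BoundedBorel) :
    Ss₁ δ = Ss₂ δ := by
  obtain ⟨N₁, hN₁, hN₁0, hs₁⟩ := h₁.singular
  obtain ⟨N₂, hN₂, hN₂0, hs₂⟩ := h₂.singular
  have hN := hN₁.union hN₂
  have hN0 : volume (N₁ ∪ N₂) = 0 := measure_union_null hN₁0 hN₂0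
  rw [h₁.singular_eq hN hN0 subset_union_left hs₁ hδ,
    h₂.singular_eq hN hN0 subset_union_right hs₂ hδ]
  exact h _ (BoundedBorel.inter_right hδ hN) (measure_mono_null inter_subset_right hN0)

end Decomposition

/-! ### Algebra of the transforms, and quadratic forms of real and imaginary parts. -/

section Transform

variable {H H₁ : Type*}
  [NormedAddCommGroup H] [InnerProductSpace ℂ H] [CompleteSpace H]
  [NormedAddCommGroup H₁] [InnerProductSpace ℂ H₁] [CompleteSpace H₁]
  {K : H →L[ℂ] H₁}

theorem inner_tilde (K : H →L[ℂ] H₁) (T : H₁ →L[ℂ] H₁) (h : H) :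
    inner ℂ h (tilde K T h) = inner ℂ (ContinuousLinearMap.adjoint K.inverse h)
      (T (ContinuousLinearMap.adjoint K.inverse h)) := by
  simp only [tilde, ContinuousLinearMap.comp_apply, ContinuousLinearMap.adjoint_inner_left]

theorem tilde_sub (K : H →L[ℂ] H₁) (T T' : H₁ →L[ℂ] H₁) :
    tilde K (T - T') = tilde K T - tilde K T' := by
  ext h
  simp [tilde]

theorem IsOperatorMeasure.tilde {S : Set ℝ → (H₁ →L[ℂ] H₁)} (hS : IsOperatorMeasure S)
    (K : H →L[ℂ] H₁) : IsOperatorMeasure fun δ => tilde K (S δ) where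
  empty := by simp [NevanlinnaOp.tilde, hS.empty]
  nonneg δ hδ := (hS.nonneg δ hδ).conj_adjoint _
  hasSum δ hδ hd hU h := (hS.hasSum δ hδ hd hU _).mapL K.inverse

/-- Together with `transform_comp_tilde`, this turns equality of the transforms into an equation
affine in the functions `F`. -/
theorem tilde_comp_transform (hK : K.IsInvertible) {B : H₁ →L[ℂ] H₁} {F : ℂ → (H₁ →L[ℂ] H₁)}
    {z : ℂ} (h : (B - F z).IsInvertible) :
    tilde K (B - F z) ∘L transform K B F z = .id ℂ H := by
  have hadj : ∀ v, ContinuousLinearMap.adjoint K.inverse (ContinuousLinearMap.adjoint K v) = v := by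
    intro v
    rw [← ContinuousLinearMap.comp_apply, ← ContinuousLinearMap.adjoint_comp, hK.self_comp_inverse,
      ContinuousLinearMap.adjoint_id]
    rfl
  ext v
  simp only [tilde, transform, ContinuousLinearMap.comp_apply, hadj, h.self_apply_inverse,
    hK.inverse_apply_self, ContinuousLinearMap.id_apply]

theorem transform_comp_tilde (hK : K.IsInvertible) {B : H₁ →L[ℂ] H₁} {F : ℂ → (H₁ →L[ℂ] H₁)}
    {z : ℂ} (h : (B - F z).IsInvertible) :
    transform K B F z ∘L tilde K (B - F z) = .id ℂ H := by
  have hadj : ∀ v, ContinuousLinearMap.adjoint K (ContinuousLinearMap.adjoint K.inverse v) = v := by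
    intro v
    rw [← ContinuousLinearMap.comp_apply, ← ContinuousLinearMap.adjoint_comp, hK.inverse_comp_self,
      ContinuousLinearMap.adjoint_id]
    rfl
  ext v
  simp only [tilde, transform, ContinuousLinearMap.comp_apply, hadj, h.inverse_apply_self,
    hK.self_apply_inverse, ContinuousLinearMap.id_apply]

theorem differentiableOn_tilde {F : ℂ → (H₁ →L[ℂ] H₁)} {U : Set ℂ}
    (hF : DifferentiableOn ℂ F U) (K : H →L[ℂ] H₁) :
    DifferentiableOn ℂ (fun z => tilde K (F z)) U := by
  unfold tilde
  exact (differentiableOn_const _).clm_comp (hF.clm_comp (differentiableOn_const _))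

theorem isOpen_setOf_isInvertible : IsOpen {T : H →L[ℂ] H | T.IsInvertible} :=
  ContinuousLinearEquiv.isOpen

theorem inner_realPart (T : H →L[ℂ] H) (h : H) :
    inner ℂ h ((ℜ T : H →L[ℂ] H) h) = ((inner ℂ h (T h)).re : ℂ) := by
  rw [realPart_apply_coe, smul_apply, add_apply, ContinuousLinearMap.star_eq_adjoint,
    inner_smul_right_eq_smul, inner_add_right, ContinuousLinearMap.adjoint_inner_right,
    ← inner_conj_symm (T h) h, Complex.add_conj, Complex.real_smul]
  push_cast
  ring

theorem inner_imaginaryPart (T : H →L[ℂ] H) (h : H) :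
    inner ℂ h ((ℑ T : H →L[ℂ] H) h) = ((inner ℂ h (T h)).im : ℂ) := by
  rw [imaginaryPart_apply_coe, smul_apply, smul_apply, sub_apply,
    ContinuousLinearMap.star_eq_adjoint, inner_smul_right, inner_smul_right_eq_smul,
    inner_sub_right, ContinuousLinearMap.adjoint_inner_right,
    ← inner_conj_symm (T h) h, Complex.sub_conj, Complex.real_smul]
  push_cast
  linear_combination -((inner ℂ h (T h)).im : ℂ) * Complex.I_sq

end Transform

/-! ### Identity theorem and comparison of parameters. -/

section Rigidity

variable {H H₁ H₂ : Type*}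
  [NormedAddCommGroup H] [InnerProductSpace ℂ H] [CompleteSpace H]
  [NormedAddCommGroup H₁] [InnerProductSpace ℂ H₁] [CompleteSpace H₁]
  [NormedAddCommGroup H₂] [InnerProductSpace ℂ H₂] [CompleteSpace H₂]
  {F₁ : ℂ → (H₁ →L[ℂ] H₁)} {F₂ : ℂ → (H₂ →L[ℂ] H₂)}
  {B₁ : H₁ →L[ℂ] H₁} {B₂ : H₂ →L[ℂ] H₂} {K₁ : H →L[ℂ] H₁} {K₂ : H →L[ℂ] H₂}

theorem isOpen_upperHalfPlane : IsOpen {z : ℂ | 0 < z.im} :=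
  isOpen_lt continuous_const Complex.continuous_im

theorem isOpen_omegaPlus (hF₁ : ContinuousOn F₁ {z | 0 < z.im})
    (hF₂ : ContinuousOn F₂ {z | 0 < z.im}) : IsOpen (OmegaPlus B₁ F₁ B₂ F₂) := by
  have h1 := (continuousOn_const (c := B₁)).sub hF₁
  have h2 := (continuousOn_const (c := B₂)).sub hF₂
  have h := (h1.isOpen_inter_preimage isOpen_upperHalfPlane isOpen_setOf_isInvertible).inter
    (h2.isOpen_inter_preimage isOpen_upperHalfPlane isOpen_setOf_isInvertible)
  convert h using 1
  ext z
  simp only [OmegaPlus, mem_ofPred_eq, mem_inter_iff, mem_preimage]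
  tauto

theorem tilde_sub_eq_of_transform_eq (hK₁ : K₁.IsInvertible) (hK₂ : K₂.IsInvertible) {z : ℂ}
    (h₁ : (B₁ - F₁ z).IsInvertible) (h₂ : (B₂ - F₂ z).IsInvertible)
    (h : transform K₁ B₁ F₁ z = transform K₂ B₂ F₂ z) :
    tilde K₁ (B₁ - F₁ z) = tilde K₂ (B₂ - F₂ z) := by
  have h3 := tilde_comp_transform hK₁ h₁
  rw [h] at h3
  exact left_inv_eq_right_inv (M := H →L[ℂ] H) h3 (transform_comp_tilde hK₂ h₂)

/-- The difference of the transformed functions is constant on the upper half-plane. -/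
theorem tilde_sub_tilde_eq (hF₁ : DifferentiableOn ℂ F₁ {z | 0 < z.im})
    (hF₂ : DifferentiableOn ℂ F₂ {z | 0 < z.im})
    (hK₁ : K₁.IsInvertible) (hK₂ : K₂.IsInvertible) (hΩ : (OmegaPlus B₁ F₁ B₂ F₂).Nonempty)
    (heq : ∀ z ∈ OmegaPlus B₁ F₁ B₂ F₂, transform K₁ B₁ F₁ z = transform K₂ B₂ F₂ z)
    {z : ℂ} (hz : 0 < z.im) :
    tilde K₁ (F₁ z) = tilde K₂ (F₂ z) + (tilde K₁ B₁ - tilde K₂ B₂) := by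
  obtain ⟨z₀, hz₀⟩ := hΩ
  have hf := (differentiableOn_tilde hF₁ K₁).analyticOnNhd isOpen_upperHalfPlane
  have hg := ((differentiableOn_tilde hF₂ K₂).add_const
    (tilde K₁ B₁ - tilde K₂ B₂)).analyticOnNhd isOpen_upperHalfPlane
  -- Agreement near `z₀` spreads over the connected half-plane, including points where `B₁ - F₁ z`
  -- or `B₂ - F₂ z` is not invertible.
  have hconn : IsPreconnected {z : ℂ | 0 < z.im} :=
    (convex_halfSpace_im_gt 0).isPreconnected
  refine hf.eqOn_of_preconnected_of_eventuallyEq hg hconn hz₀.1 ?_ hz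
  filter_upwards [(isOpen_omegaPlus hF₁.continuousOn hF₂.continuousOn).mem_nhds hz₀] with w hw
  have h := tilde_sub_eq_of_transform_eq hK₁ hK₂ hw.2.1 hw.2.2 (heq w hw)
  rw [tilde_sub, tilde_sub] at h
  rw [← sub_eq_zero] at h ⊢
  rw [← neg_eq_zero, ← h]
  abel

variable {C₁ D₁ : H₁ →L[ℂ] H₁} {C₂ D₂ : H₂ →L[ℂ] H₂}
  {S₁ : Set ℝ → (H₁ →L[ℂ] H₁)} {S₂ : Set ℝ → (H₂ →L[ℂ] H₂)}

/-- Comparison of the integral representations of two functions whose transforms differ by a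
constant on the upper half-plane. -/
theorem tilde_params_eq (hS₁ : HasIntegralRepresentation F₁ C₁ D₁ S₁)
    (hS₂ : HasIntegralRepresentation F₂ C₂ D₂ S₂) {G : H →L[ℂ] H}
    (hG : ∀ z : ℂ, 0 < z.im → tilde K₁ (F₁ z) = tilde K₂ (F₂ z) + G) :
    (∀ δ ∈ BoundedBorel, tilde K₁ (S₁ δ) =
      tilde K₂ (S₂ δ) + (volume.real δ / Real.pi) • (ℑ G : H →L[ℂ] H)) ∧
    tilde K₁ C₁ = tilde K₂ C₂ + (ℜ G : H →L[ℂ] H) ∧ tilde K₁ D₁ = tilde K₂ D₂ := by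
  have key : ∀ h : H,
      (∀ δ ∈ BoundedBorel, inner ℂ h (tilde K₁ (S₁ δ) h) = inner ℂ h
        ((tilde K₂ (S₂ δ) + (volume.real δ / Real.pi) • (ℑ G : H →L[ℂ] H)) h)) ∧
      inner ℂ h (tilde K₁ C₁ h) = inner ℂ h ((tilde K₂ C₂ + (ℜ G : H →L[ℂ] H)) h) ∧
      inner ℂ h (tilde K₁ D₁ h) = inner ℂ h (tilde K₂ D₂ h) := by
    intro h
    -- Forms of `tilde` operators at `h` are forms of the original operators at these vectors, so
    -- each representation is used in its own space.
    set k₁ := ContinuousLinearMap.adjoint K₁.inverse h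
    set k₂ := ContinuousLinearMap.adjoint K₂.inverse h
    obtain ⟨μ₁, _, hint₁, hμ₁, him₁, hre₁⟩ := hS₁.exists_scalar k₁
    obtain ⟨μ₂, _, hint₂, hμ₂, him₂, hre₂⟩ := hS₂.exists_scalar k₂
    have hFz : ∀ z : ℂ, 0 < z.im →
        inner ℂ k₁ (F₁ z k₁) = inner ℂ k₂ (F₂ z k₂) + inner ℂ h (G h) := by
      intro z hz
      rw [← inner_tilde, ← inner_tilde, hG z hz, add_apply, inner_add_right]
    -- Imaginary parts at `z = x + i y`: the `D` terms supply the slope and `G` the constant.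
    have hP : ∀ x y : ℝ, 0 < y → ∫ t, y / ((t - x) ^ 2 + y ^ 2) ∂μ₁ =
        ∫ t, y / ((t - x) ^ 2 + y ^ 2) ∂μ₂ +
          ((inner ℂ k₂ (D₂ k₂)).re - (inner ℂ k₁ (D₁ k₁)).re) * y + (inner ℂ h (G h)).im := by
      intro x y hy
      have hz : 0 < (⟨x, y⟩ : ℂ).im := hy
      have h1 := congrArg Complex.im (hFz ⟨x, y⟩ hz)
      rw [Complex.add_im, him₁ _ hz, him₂ _ hz] at h1
      dsimp only at h1
      linarith
    obtain ⟨hd, hs⟩ := measure_and_coeff_eq_of_poissonIntegral_eq hint₁ hint₂ hP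
    refine ⟨fun δ hδ => ?_, ?_, ?_⟩
    · rw [inner_tilde, add_apply, smul_apply, inner_add_right, inner_tilde, (hμ₁ δ hδ).2,
        (hμ₂ δ hδ).2, hs δ (hμ₁ δ hδ).1 (hμ₂ δ hδ).1 hδ.2.measure_lt_top.ne,
        inner_smul_right_eq_smul, inner_imaginaryPart, Complex.real_smul]
      push_cast
      ring
    · have h1 := congrArg Complex.re (hFz Complex.I (by simp))
      rw [Complex.add_re, hre₁, hre₂] at h1
      rw [add_apply, inner_add_right, inner_tilde, inner_tilde, inner_realPart]
      refine Complex.ext (by simpa using h1) ?_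
      simp [im_inner_of_isSelfAdjoint hS₁.selfAdjoint_C,
        im_inner_of_isSelfAdjoint hS₂.selfAdjoint_C]
    · rw [inner_tilde, inner_tilde, ← coe_re_inner_of_isPositive hS₁.nonneg_D,
        ← coe_re_inner_of_isPositive hS₂.nonneg_D]
      exact congrArg _ (sub_eq_zero.1 hd).symm
  exact ⟨fun δ hδ => eq_of_inner_eq fun h => (key h).1 δ hδ,
    eq_of_inner_eq fun h => (key h).2.1, eq_of_inner_eq fun h => (key h).2.2⟩

end Rigidity

end NevanlinnaOp

theorem lemma3p1 {H H₁ H₂ : Type*}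
    [NormedAddCommGroup H] [InnerProductSpace ℂ H] [CompleteSpace H]
    [TopologicalSpace.SeparableSpace H]
    [NormedAddCommGroup H₁] [InnerProductSpace ℂ H₁] [CompleteSpace H₁]
    [NormedAddCommGroup H₂] [InnerProductSpace ℂ H₂] [CompleteSpace H₂]
    (F₁ : ℂ → (H₁ →L[ℂ] H₁)) (F₂ : ℂ → (H₂ →L[ℂ] H₂))
    (hF₁ : NevanlinnaOp.IsRFunction F₁) (hF₂ : NevanlinnaOp.IsRFunction F₂)
    (C₁ D₁ : H₁ →L[ℂ] H₁) (C₂ D₂ : H₂ →L[ℂ] H₂)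
    (S₁ : Set ℝ → (H₁ →L[ℂ] H₁)) (S₂ : Set ℝ → (H₂ →L[ℂ] H₂))
    (hS₁ : NevanlinnaOp.HasIntegralRepresentation F₁ C₁ D₁ S₁)
    (hS₂ : NevanlinnaOp.HasIntegralRepresentation F₂ C₂ D₂ S₂)
    (B₁ : H₁ →L[ℂ] H₁) (B₂ : H₂ →L[ℂ] H₂)
    (K₁ : H →L[ℂ] H₁) (K₂ : H →L[ℂ] H₂)
    (hK₁ : K₁.IsInvertible) (hK₂ : K₂.IsInvertible)
    (hΩ : (NevanlinnaOp.OmegaPlus B₁ F₁ B₂ F₂).Nonempty)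
    (heq : ∀ z ∈ NevanlinnaOp.OmegaPlus B₁ F₁ B₂ F₂,
      NevanlinnaOp.transform K₁ B₁ F₁ z = NevanlinnaOp.transform K₂ B₂ F₂ z) :
    -- the Lebesgue decompositions of the two transformed measures exist,
    (∃ Sac₁ Ss₁, NevanlinnaOp.IsLebesgueDecomposition
      (fun δ => NevanlinnaOp.tilde K₁ (S₁ δ)) Sac₁ Ss₁) ∧
    (∃ Sac₂ Ss₂, NevanlinnaOp.IsLebesgueDecomposition
      (fun δ => NevanlinnaOp.tilde K₂ (S₂ δ)) Sac₂ Ss₂) ∧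
    -- and their parts (whichever way they are chosen) are related as claimed
    (∀ Sac₁ Ss₁ Sac₂ Ss₂ : Set ℝ → (H →L[ℂ] H),
      NevanlinnaOp.IsLebesgueDecomposition (fun δ => NevanlinnaOp.tilde K₁ (S₁ δ)) Sac₁ Ss₁ →
      NevanlinnaOp.IsLebesgueDecomposition (fun δ => NevanlinnaOp.tilde K₂ (S₂ δ)) Sac₂ Ss₂ →
      ∀ δ ∈ NevanlinnaOp.BoundedBorel,
        Ss₁ δ = Ss₂ δ ∧
        Sac₂ δ - Sac₁ δ = (volume.real δ / Real.pi) •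
          ((ℑ (NevanlinnaOp.tilde K₂ B₂) : H →L[ℂ] H) -
            (ℑ (NevanlinnaOp.tilde K₁ B₁) : H →L[ℂ] H))) ∧
    NevanlinnaOp.tilde K₁ C₁ - (ℜ (NevanlinnaOp.tilde K₁ B₁) : H →L[ℂ] H) =
      NevanlinnaOp.tilde K₂ C₂ - (ℜ (NevanlinnaOp.tilde K₂ B₂) : H →L[ℂ] H) ∧
    NevanlinnaOp.tilde K₁ D₁ = NevanlinnaOp.tilde K₂ D₂ := by
  have hsub : {z : ℂ | 0 < z.im} ⊆ {z | z.im ≠ 0} := fun z hz => ne_of_gt hz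
  obtain ⟨hS, hC, hD⟩ := NevanlinnaOp.tilde_params_eq hS₁ hS₂ fun z hz =>
    NevanlinnaOp.tilde_sub_tilde_eq (hF₁.holomorphic.mono hsub) (hF₂.holomorphic.mono hsub)
      hK₁ hK₂ hΩ heq hz
  refine ⟨(hS₁.measure.tilde K₁).exists_isLebesgueDecomposition,
    (hS₂.measure.tilde K₂).exists_isLebesgueDecomposition, ?_, ?_, hD⟩
  · intro Sac₁ Ss₁ Sac₂ Ss₂ h₁ h₂ δ hδ
    -- The two measures differ by an operator multiple of `volume`, hence agree on null sets.
    have hs : Ss₁ δ = Ss₂ δ := h₁.singular_eq_singular h₂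
      (fun ε hε h0 => by simp [hS ε hε, Measure.real, h0]) hδ
    refine ⟨hs, ?_⟩
    have h := hS δ hδ
    rw [h₁.add δ hδ, h₂.add δ hδ, hs, map_sub, AddSubgroupClass.coe_sub] at h
    have h' : Sac₁ δ = Sac₂ δ + (volume.real δ / Real.pi) •
        ((ℑ (NevanlinnaOp.tilde K₁ B₁) : H →L[ℂ] H) -
          (ℑ (NevanlinnaOp.tilde K₂ B₂) : H →L[ℂ] H)) := by
      rw [← sub_eq_zero] at h ⊢
      rw [← h]
      abel
    rw [h', sub_add_cancel_left, ← smul_neg, neg_sub]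
  · rw [hC, map_sub, AddSubgroupClass.coe_sub]
    abel
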